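/- Let $\mathcal V=\coprod_{x\in D}\mathcal V_x\to D$ be a holomorphic vector bundle of finite rank over a connected complex manifold $D$, equipped with a smooth Hermitian metric. Let $H$ be a Lie group acting on $\mathcal V\to D$ by automorphisms: $H$ acts on $D$ and on the total space $\mathcal V$ compatibly with the projection, every $h\in H$ acts by biholomorphic maps $x\mapsto h\cdot x$ on $D$ and $L_h:\mathcal V\to\mathcal V$, and $L_h:\mathcal V_x\to\mathcal V_{h\cdot x}$ is linear and unitary for every $x\in D$. For $x \in D$ let $H_x=\{h\in H: h\cdot x=x\}$, which acts unitarily on $\mathcal V_x$ (the isotropy representation). Call a unitary representation of a group multiplicity-free if the ring of its continuous intertwining endomorphisms is commutative. Assume that for every $x\in D$ the isotropy representation of $H_x$ on $\mathcal V_x$ is multiplicity-free, and write its decomposition into irreducible subrepresentations as $\mathcal V_x=\bigoplus_{i=1}^{n(x)}\mathcal V_x^{(i)}$. Assume furthermore that there is an anti-holomorphic bundle endomorphism $\sigma$ of $\mathcal V$, i.e. an anti-holomorphic map $\sigma:\mathcal V\to\mathcal V$ covering an anti-holomorphic map $\sigma:D\to D$ such that each $\sigma_x:\mathcal V_x\to\mathcal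 V_{\sigma(x)}$ is a conjugate-linear isometric isomorphism, with the following property: for every $x\in D$ there exists $h\in H$ such that $\sigma(x)=h\cdot x$ and $$\sigma_x(\mathcal V_x^{(i)})=L_h(\mathcal V_x^{(i)})\qquad\text{for all } 1\le i\le n(x).$$ Let $\mathcal O(D,\mathcal V)$ be the space of holomorphic sections with the topology of uniform convergence on compact sets, on which $h\in H$ acts by $s\mapsto L_h\, s(h^{-1}\cdot\ )$. Then every (strongly continuous) unitary representation $(\pi,\mathcal H)$ of $H$ on a Hilbert space that is realized in $\mathcal O(D,\mathcal V)$, i.e. for which there is an injective continuous linear $H$-intertwining map $\mathcal H\to\mathcal O(D,\mathcal V)$, is multiplicity-free. -/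

import Mathlib

open scoped Manifold ContDiff Bundle Topology ComplexConjugate

noncomputable section

section Representations

variable {G : Type*} [Group G] {𝓗 : Type*} [NormedAddCommGroup 𝓗] [InnerProductSpace ℂ 𝓗]

/-- The underlying linear representation of a group homomorphism into the unitary operators. -/
def unitaryToRepresentation (ρ : G →* (𝓗 ≃ₗᵢ[ℂ] 𝓗)) : Representation ℂ G 𝓗 where
  toFun g := (ρ g).toLinearEquiv.toLinearMap
  map_one' := by ext v; simp
  map_mul' g h := by ext v; simp

/-- A group of unitary operators is multiplicity-free if the ring of continuous intertwining
endomorphisms is commutative. -/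
def IsMultiplicityFree (ρ : G →* (𝓗 ≃ₗᵢ[ℂ] 𝓗)) : Prop :=
  ∀ A B : 𝓗 →L[ℂ] 𝓗,
    (∀ g v, A (ρ g v) = ρ g (A v)) → (∀ g v, B (ρ g v) = ρ g (B v)) → A ∘L B = B ∘L A

/-- The family `W` of subrepresentations is a decomposition of `ρ` into a direct sum of
irreducible subrepresentations. -/
structure IsIrreducibleDecomposition {ι : Type*} [DecidableEq ι] {ρ : Representation ℂ G 𝓗}
    (W : ι → Subrepresentation ρ) : Prop where
  isInternal : DirectSum.IsInternal fun i => (W i).toSubmodule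
  irreducible : ∀ i, (W i).toRepresentation.IsIrreducible

end Representations

/-- A map between (the real manifolds underlying) complex manifolds is anti-holomorphic if at every
point it is real differentiable with a conjugate-linear differential. Here `I` and `J` are the real
models of the two manifolds, and `E` and `E'` are the complex model spaces. -/
def IsAntiholomorphic
    {E : Type*} [NormedAddCommGroup E] [NormedSpace ℝ E] [Module ℂ E]
    {E' : Type*} [NormedAddCommGroup E'] [NormedSpace ℝ E'] [Module ℂ E']
    {X : Type*} [TopologicalSpace X] (I : ModelWithCorners ℝ E X)
    {X' : Type*} [TopologicalSpace X'] (J : ModelWithCorners ℝ E' X')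
    {M : Type*} [TopologicalSpace M] [ChartedSpace X M]
    {M' : Type*} [TopologicalSpace M'] [ChartedSpace X' M'] (f : M → M') : Prop :=
  ∀ x, ∃ A : E →L[ℝ] E', HasMFDerivAt I J f x A ∧ ∀ v, A (Complex.I • v) = -(Complex.I • A v)

section Bundles

variable (E : Type*) [NormedAddCommGroup E] [NormedSpace ℂ E]
  {D : Type*} [TopologicalSpace D] [ChartedSpace E D]
  (F : Type*) [NormedAddCommGroup F] [NormedSpace ℂ F]
  (V : D → Type*) [TopologicalSpace (Bundle.TotalSpace F V)]
  [∀ x, NormedAddCommGroup (V x)] [∀ x, InnerProductSpace ℂ (V x)]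
  [FiberBundle F V]

/-- The inner products on the fibers form a Hermitian metric, i.e. they depend smoothly (in the real
sense) on the base point: in each trivialization of the bundle, the matrix coefficients of the
metric are smooth functions. -/
class IsHermitianBundle : Prop where
  contMDiffOn_inner : ∀ (e : Bundle.Trivialization F
      (Bundle.TotalSpace.proj : Bundle.TotalSpace F V → D)) [MemTrivializationAtlas e] (u w : F),
    ContMDiffOn 𝓘(ℝ, E) 𝓘(ℝ, ℂ) ∞ (fun x => inner ℂ (e.symm x u) (e.symm x w)) e.baseSet

/-- The space `𝓞(D, V)` of holomorphic sections. -/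
abbrev HolomorphicSection [VectorBundle ℂ F V] : Type _ :=
  ContMDiffSection 𝓘(ℂ, E) F ω V

/-- The topology of uniform convergence on compact sets on `𝓞(D, V)`. -/
abbrev compactConvergence [VectorBundle ℂ F V] : TopologicalSpace (HolomorphicSection E F V) :=
  TopologicalSpace.generateFrom
    {U | ∃ (s : HolomorphicSection E F V) (K : Set D) (ε : ℝ), IsCompact K ∧ 0 < ε ∧
      U = {t | ∀ x ∈ K, ‖t x - s x‖ < ε}}

/-- An anti-holomorphic endomorphism of a Hermitian holomorphic vector bundle: an anti-holomorphic
map of the total space covering an anti-holomorphic map of the base, which is a conjugate-linear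
isometric isomorphism between the fibers. -/
structure AntiholomorphicBundleEnd where
  base : D → D
  fiber : ∀ x, V x ≃ₛₗᵢ[starRingEnd ℂ] V (base x)
  isAntiholomorphic_base : IsAntiholomorphic 𝓘(ℝ, E) 𝓘(ℝ, E) base
  isAntiholomorphic_total :
    IsAntiholomorphic (𝓘(ℝ, E).prod 𝓘(ℝ, F)) (𝓘(ℝ, E).prod 𝓘(ℝ, F))
      (fun p : Bundle.TotalSpace F V => (⟨base p.1, fiber p.1 p.2⟩ : Bundle.TotalSpace F V))

/-- An action of a group `H` on a Hermitian holomorphic vector bundle by automorphisms, lifting a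
given action on the base: `h : H` acts by biholomorphic maps on the base and on the total space (the
inverses of these maps are given by `h⁻¹`), and by unitary maps `L h x : V x → V (h • x)` between
the fibers. -/
structure HolomorphicBundleAction (H : Type*) [Group H] [MulAction H D] where
  L : ∀ (h : H) (x : D), V x ≃ₗᵢ[ℂ] V (h • x)
  one_act : ∀ x (v : V x),
    (⟨(1 : H) • x, L 1 x v⟩ : Bundle.TotalSpace F V) = ⟨x, v⟩
  mul_act : ∀ (g h : H) x (v : V x),
    (⟨(g * h) • x, L (g * h) x v⟩ : Bundle.TotalSpace F V) = ⟨g • h • x, L g (h • x) (L h x v)⟩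
  holomorphic_base : ∀ h : H, ContMDiff 𝓘(ℂ, E) 𝓘(ℂ, E) ω (fun x : D => h • x)
  holomorphic_total : ∀ h : H,
    ContMDiff (𝓘(ℂ, E).prod 𝓘(ℂ, F)) (𝓘(ℂ, E).prod 𝓘(ℂ, F)) ω
      (fun p : Bundle.TotalSpace F V => (⟨h • p.1, L h p.1 p.2⟩ : Bundle.TotalSpace F V))

variable {E} {F} {V} {H : Type*} [Group H] [MulAction H D]

/-- The map induced on the total space. -/
def AntiholomorphicBundleEnd.total (σ : AntiholomorphicBundleEnd E F V)
    (p : Bundle.TotalSpace F V) : Bundle.TotalSpace F V :=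
  ⟨σ.base p.1, σ.fiber p.1 p.2⟩

/-- The identification of the fibers over equal points. -/
def fiberCongr (V : D → Type*) [∀ x, NormedAddCommGroup (V x)] [∀ x, InnerProductSpace ℂ (V x)]
    {x y : D} (h : x = y) : V x ≃ₗᵢ[ℂ] V y :=
  h ▸ LinearIsometryEquiv.refl ℂ (V x)

theorem mk_fiberCongr {D : Type*} {F : Type*} {V : D → Type*}
    [∀ x, NormedAddCommGroup (V x)] [∀ x, InnerProductSpace ℂ (V x)] {x y : D} (h : x = y) (v : V x) :
    (⟨y, fiberCongr V h v⟩ : Bundle.TotalSpace F V) = ⟨x, v⟩ := by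
  subst h
  rfl

namespace HolomorphicBundleAction

/-- The action on the total space. -/
def act (a : HolomorphicBundleAction E F V H) (h : H) (p : Bundle.TotalSpace F V) :
    Bundle.TotalSpace F V :=
  ⟨h • p.1, a.L h p.1 p.2⟩

theorem act_one (a : HolomorphicBundleAction E F V H) (p : Bundle.TotalSpace F V) :
    a.act 1 p = p := a.one_act p.1 p.2

theorem act_mul (a : HolomorphicBundleAction E F V H) (g h : H) (p : Bundle.TotalSpace F V) :
    a.act (g * h) p = a.act g (a.act h p) := a.mul_act g h p.1 p.2

/-- The operator `L h : V x → V (h • x) = V x` for `h` in the isotropy subgroup of `x`. -/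
def isotropyOp (a : HolomorphicBundleAction E F V H) (x : D) (h : MulAction.stabilizer H x) :
    V x ≃ₗᵢ[ℂ] V x :=
  (a.L (h : H) x).trans (fiberCongr V h.2)

theorem mk_isotropyOp (a : HolomorphicBundleAction E F V H) (x : D)
    (h : MulAction.stabilizer H x) (v : V x) :
    (⟨x, a.isotropyOp x h v⟩ : Bundle.TotalSpace F V) = a.act h ⟨x, v⟩ :=
  mk_fiberCongr h.2 _

/-- The isotropy representation of `H_x` on the fiber `V x`. -/
def isotropyRep (a : HolomorphicBundleAction E F V H) (x : D) :
    MulAction.stabilizer H x →* (V x ≃ₗᵢ[ℂ] V x) where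
  toFun := a.isotropyOp x
  map_one' := by
    ext v
    apply Bundle.TotalSpace.mk_injective (F := F) x
    exact (a.mk_isotropyOp x 1 v).trans (a.act_one _)
  map_mul' g h := by
    ext v
    apply Bundle.TotalSpace.mk_injective (F := F) x
    refine (a.mk_isotropyOp x (g * h) v).trans ?_
    refine (a.act_mul g h _).trans ?_
    rw [← a.mk_isotropyOp x h v]
    exact (a.mk_isotropyOp x g _).symm

/-- The unitary representation `U` is realized in `𝓞(D, V)`: there is an injective continuous linear
map `T : 𝓗 → 𝓞(D, V)` which intertwines `U` with the action `s ↦ L_h (s (h⁻¹ • ·))` on sections,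
i.e. the value of `T (U h f)` at `h • x` is `L_h` applied to the value of `T f` at `x`. -/
def IsRealized [VectorBundle ℂ F V] (a : HolomorphicBundleAction E F V H)
    {𝓗 : Type*} [NormedAddCommGroup 𝓗] [InnerProductSpace ℂ 𝓗] (U : H →* (𝓗 ≃ₗᵢ[ℂ] 𝓗)) : Prop :=
  ∃ T : 𝓗 →ₗ[ℂ] HolomorphicSection E F V,
    Function.Injective T ∧
    Continuous[inferInstance, compactConvergence E F V] T ∧
    ∀ (h : H) (f : 𝓗) (x : D), T (U h f) (h • x) = a.L h x (T f x)

end HolomorphicBundleAction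

end Bundles

end

/-! Write S for `coherentVector T hT`: for p = (x, u), S p is the Riesz vector of f ↦ ⟪u, (T f) x⟫.
Since `T` is injective, these vectors span a dense subspace. For C in the commutant of `U`, the
numbers ⟪S p, C (S q)⟫ form the reproducing kernel of C, and everything rests on the identity ⟪S (σ
p), C (S (σ q))⟫ = ⟪S q, C (S p)⟫.

Over a single point x the kernel is an operator K on `V x` commuting with the isotropy group.
Multiplicity-freeness makes K scalar on each irreducible constituent and makes the constituents
mutually orthogonal. Over x, σ = L_h ∘ τ with τ anti-unitary and preserving every constituent, so τ
conjugates K to its adjoint, and L_h drops out by equivariance (`inner_coherentVector_total_self`).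
In local frames both sides are holomorphic in one base point and antiholomorphic in the other, so
the identity spreads off the diagonal and, D being connected, to all pairs
(`inner_coherentVector_of_diagonal`).

With C = 1 it shows that S p ↦ S (σ p) extends to a conjugate-linear isometry J; for general C it
says J* C J = C*. For self-adjoint C this forces C J = J C, so J* A B J equals both (A B)* = B A and
A B (`mul_comm_of_isSelfAdjoint_of_anti_pairing`). Surjectivity of J is not needed. -/

noncomputable section

/-! ### Weakly holomorphic families of functionals -/

/-- A family of continuous linear functionals on a Banach space that is pointwise holomorphic on an
open set is continuous in norm. -/
theorem ContinuousOn.of_forall_apply_differentiableOn {X : Type*} [NormedAddCommGroup X]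
    [NormedSpace ℂ X] [CompleteSpace X] {Φ : ℂ → X →L[ℂ] ℂ} {S : Set ℂ} (hS : IsOpen S)
    (h : ∀ f, DifferentiableOn ℂ (fun s => Φ s f) S) : ContinuousOn Φ S := by
  intro z hz
  refine ContinuousAt.continuousWithinAt ?_
  obtain ⟨r, hr, hrS⟩ := Metric.nhds_basis_closedBall.mem_iff.1 (hS.mem_nhds hz)
  obtain ⟨C, hC⟩ : ∃ C, ∀ w : Metric.closedBall z r, ‖Φ w‖ ≤ C := by
    refine banach_steinhaus fun f => ?_
    obtain ⟨C, hC⟩ := (isCompact_closedBall z r).exists_bound_of_continuousOn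
      ((h f).continuousOn.mono hrS)
    exact ⟨C, fun w => hC w w.2⟩
  have hC0 : 0 ≤ C := (norm_nonneg _).trans (hC ⟨z, Metric.mem_closedBall_self hr.le⟩)
  -- The Schwarz lemma for s ↦ Φ s f, whose oscillation is at most 2C‖f‖, gives a Lipschitz bound
  -- that is linear in ‖f‖, hence a bound in operator norm.
  have key : ∀ w ∈ Metric.ball z r, ‖Φ w - Φ z‖ ≤ (2 * C / r) * dist w z := by
    intro w hw
    refine ContinuousLinearMap.opNorm_le_bound _ (by positivity) fun f => ?_
    have := Complex.dist_le_div_mul_dist_of_mapsTo_ball (f := fun s => Φ s f) (c := z) (R₁ := r)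
      (R₂ := 2 * C * ‖f‖) ((h f).mono (Metric.ball_subset_closedBall.trans hrS)) (fun v hv => by
        rw [mem_closedBall_iff_norm]
        have h1 := (Φ v).le_of_opNorm_le (hC ⟨v, Metric.ball_subset_closedBall hv⟩) f
        have h2 := (Φ z).le_of_opNorm_le (hC ⟨z, Metric.mem_closedBall_self hr.le⟩) f
        linarith [norm_sub_le (Φ v f) (Φ z f)]) hw
    rw [dist_eq_norm] at this
    refine this.trans_eq ?_
    ring
  rw [ContinuousAt, tendsto_iff_norm_sub_tendsto_zero]
  have hlim : Filter.Tendsto (fun w => (2 * C / r) * dist w z) (𝓝 z) (𝓝 0) := by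
    have : Continuous fun w => (2 * C / r) * dist w z := by fun_prop
    simpa using this.tendsto z
  refine squeeze_zero' (Filter.Eventually.of_forall fun _ => norm_nonneg _) ?_ hlim
  filter_upwards [Metric.ball_mem_nhds z hr] with w hw using key w hw

/-- A family of continuous linear functionals on a Banach space that is pointwise holomorphic is
holomorphic in norm. -/
theorem DifferentiableOn.of_forall_apply {X : Type*} [NormedAddCommGroup X]
    [NormedSpace ℂ X] [CompleteSpace X] {Φ : ℂ → X →L[ℂ] ℂ} {S : Set ℂ} (hS : IsOpen S)
    (h : ∀ f, DifferentiableOn ℂ (fun s => Φ s f) S) : DifferentiableOn ℂ Φ S := by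
  have hcont := ContinuousOn.of_forall_apply_differentiableOn hS h
  intro z hz
  refine DifferentiableAt.differentiableWithinAt ?_
  obtain ⟨r, hr, hrS⟩ := Metric.nhds_basis_closedBall.mem_iff.1 (hS.mem_nhds hz)
  lift r to NNReal using hr.le
  have hcs : ContinuousOn Φ (Metric.sphere z r) :=
    hcont.mono (Metric.sphere_subset_closedBall.trans hrS)
  -- The Cauchy integral of a norm-continuous family is analytic; that it equals Φ is checked on
  -- each f by the scalar Cauchy formula.
  have hps := hasFPowerSeriesOn_cauchy_integral (hcs.circleIntegrable r.2) hr
  refine hps.differentiableOn.differentiableAt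
    (Metric.eball_mem_nhds z (by exact_mod_cast hr)) |>.congr_of_eventuallyEq ?_
  filter_upwards [Metric.ball_mem_nhds z hr] with w hw
  have hci : CircleIntegrable (fun ζ => (ζ - w)⁻¹ • Φ ζ) z r := by
    refine ContinuousOn.circleIntegrable r.2
      (((continuousOn_id.sub continuousOn_const).inv₀ ?_).smul hcs)
    intro ζ hζ h0
    obtain rfl : ζ = w := sub_eq_zero.1 h0
    rw [Metric.mem_sphere] at hζ
    rw [Metric.mem_ball] at hw
    linarith
  ext f
  have h1 := ((h f).mono hrS).diffContOnCl_ball subset_rfl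
    |>.two_pi_i_inv_smul_circleIntegral_sub_inv_smul hw
  have h2 : (∮ ζ in C(z, r), (ζ - w)⁻¹ • Φ ζ) f = ∮ ζ in C(z, r), (ζ - w)⁻¹ • Φ ζ f := by
    simp only [circleIntegral]
    rw [← ContinuousLinearMap.apply_apply (𝕜 := ℂ) f,
      ← ContinuousLinearMap.intervalIntegral_comp_comm _ hci.out]
    rfl
  rw [smul_apply, h2, h1]

/-! ### Uniqueness on totally real subspaces -/

/-- A holomorphic function on a neighbourhood of the disc of radius `ρ` that vanishes on the reals
vanishes. -/
theorem eq_zero_of_forall_real_eq_zero {f : ℂ → ℂ} {ρ : ℝ} (hρ : 0 < ρ)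
    (hf : DifferentiableOn ℂ f (Metric.ball 0 ρ))
    (h0 : ∀ x : ℝ, |x| < ρ → f x = 0) {z : ℂ} (hz : z ∈ Metric.ball (0 : ℂ) ρ) : f z = 0 := by
  have han := hf.analyticOnNhd Metric.isOpen_ball
  refine han.eqOn_zero_of_preconnected_of_frequently_eq_zero
    (convex_ball (0 : ℂ) ρ).isPreconnected (Metric.mem_ball_self hρ) ?_ hz
  have htend : Filter.Tendsto (fun x : ℝ => (x : ℂ)) (𝓝[≠] 0) (𝓝[≠] 0) := by
    refine tendsto_nhdsWithin_iff.2 ⟨?_, ?_⟩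
    · exact (Complex.continuous_ofReal.tendsto' 0 0 (by simp)).mono_left nhdsWithin_le_nhds
    · filter_upwards [self_mem_nhdsWithin] with x hx
      simpa using hx
  refine htend.frequently (Filter.Eventually.frequently ?_)
  filter_upwards [nhdsWithin_le_nhds (Metric.ball_mem_nhds (0 : ℝ) hρ)] with x hx
  exact h0 x (by simpa using hx)

/-- A holomorphic function of two variables vanishing on the totally real subspace `s = conj t`
vanishes. -/
theorem eq_zero_of_forall_conj_diagonal {G : ℂ × ℂ → ℂ}
    (hG : DifferentiableOn ℂ G (Metric.ball 0 2 ×ˢ Metric.ball 0 2))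
    (h0 : ∀ z ∈ Metric.ball (0 : ℂ) 2, G (conj z, z) = 0) : G (1, 0) = 0 := by
  -- In the coordinates s = p - iq, t = p + iq, the subspace s = conj t is the real plane, so p and
  -- q can be freed from the reals one at a time.
  set P : ℂ → ℂ → ℂ := fun p q => G (p - Complex.I * q, p + Complex.I * q) with hP
  have hmem : ∀ p ∈ Metric.ball (0 : ℂ) 1, ∀ q ∈ Metric.ball (0 : ℂ) 1,
      (p - Complex.I * q, p + Complex.I * q) ∈ Metric.ball (0 : ℂ) 2 ×ˢ Metric.ball (0 : ℂ) 2 := by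
    intro p hp q hq
    simp only [mem_ball_zero_iff, Set.mem_prod] at hp hq ⊢
    have h1 := norm_sub_le p (Complex.I * q)
    have h2 := norm_add_le p (Complex.I * q)
    have h3 : ‖Complex.I * q‖ = ‖q‖ := by simp
    constructor <;> linarith
  have hreal : ∀ p q : ℝ, |p| < 1 → |q| < 1 → P p q = 0 := by
    intro p q hp hq
    have := h0 (p + Complex.I * q) (hmem p (by simpa using hp) q (by simpa using hq)).2
    simpa [hP, sub_eq_add_neg] using this
  have hstep : ∀ q : ℝ, |q| < 1 → ∀ p ∈ Metric.ball (0 : ℂ) 1, P p q = 0 := by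
    intro q hq p hp
    refine eq_zero_of_forall_real_eq_zero (f := fun p => P p q) one_pos ?_
      (fun p hp => hreal p q hp hq) hp
    exact hG.comp (by fun_prop) fun p hp => hmem p hp q (by simpa using hq)
  have hfin : ∀ p ∈ Metric.ball (0 : ℂ) 1, ∀ q ∈ Metric.ball (0 : ℂ) 1, P p q = 0 := by
    intro p hp q hq
    refine eq_zero_of_forall_real_eq_zero (f := fun q => P p q) one_pos ?_
      (fun q hq => hstep q hq p hp) hq
    exact hG.comp (by fun_prop) fun q hq => hmem p hp q hq
  -- p = 1/2, q = i/2 correspond to s = 1, t = 0.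
  have := hfin (1 / 2) (by norm_num) (Complex.I / 2) (by norm_num)
  have e : Complex.I * (Complex.I / 2) = -(1 / 2) := by
    linear_combination (1 / 2) * Complex.I_mul_I
  simp only [hP, e] at this
  norm_num at this
  exact this

theorem DifferentiableOn.clm_apply_prod {Y : Type*} [NormedAddCommGroup Y] [NormedSpace ℂ Y]
    {α : ℂ → Y} {β : ℂ → Y →L[ℂ] ℂ} {S T : Set ℂ} (hα : DifferentiableOn ℂ α S)
    (hβ : DifferentiableOn ℂ β T) :
    DifferentiableOn ℂ (fun p : ℂ × ℂ => β p.2 (α p.1)) (S ×ˢ T) :=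
  (hβ.comp (g := β) differentiableOn_snd fun _ hp => hp.2).clm_apply
    (hα.comp (g := α) differentiableOn_fst fun _ hp => hp.1)

/-! ### Polarization along complex lines -/

section Lines

variable {E : Type*} [NormedAddCommGroup E] [NormedSpace ℂ E]

/-- Halving the radius leaves room for parameters in the disc of radius 2, which contains both 0
(the center) and 1 (the point z). -/
theorem line_mem_ball {c z : E} {r : ℝ} (hz : z ∈ Metric.ball c (r / 2)) {s : ℂ}
    (hs : s ∈ Metric.ball (0 : ℂ) 2) : c + s • (z - c) ∈ Metric.ball c r := by
  rw [mem_ball_iff_norm] at hz ⊢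
  rw [mem_ball_zero_iff] at hs
  rw [add_sub_cancel_left, norm_smul]
  nlinarith [norm_nonneg s, norm_nonneg (z - c)]

theorem DifferentiableOn.comp_line {f : E → ℂ} {c z : E} {r : ℝ}
    (hf : DifferentiableOn ℂ f (Metric.ball c r)) (hz : z ∈ Metric.ball c (r / 2)) :
    DifferentiableOn ℂ (fun s : ℂ => f (c + s • (z - c))) (Metric.ball 0 2) :=
  hf.comp (g := f) (by fun_prop) fun _ hs => line_mem_ball hz hs

theorem DifferentiableOn.conj_conj_ball {f : ℂ → ℂ} {ρ : ℝ}
    (hf : DifferentiableOn ℂ f (Metric.ball 0 ρ)) :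
    DifferentiableOn ℂ (fun s => conj (f (conj s))) (Metric.ball 0 ρ) := by
  intro s hs
  have hs' : conj s ∈ Metric.ball (0 : ℂ) ρ := by simpa using hs
  have := (hf.differentiableAt (Metric.isOpen_ball.mem_nhds hs')).conj_conj
  rw [Complex.conj_conj] at this
  exact this.differentiableWithinAt

/-- A holomorphic function on a ball vanishing near the center vanishes. -/
theorem eq_zero_of_forall_ball_of_eventually {f : E → ℂ} {c : E} {r : ℝ}
    (hf : DifferentiableOn ℂ f (Metric.ball c r)) {w : E} (hw : w ∈ Metric.ball c r)
    (h0 : ∀ᶠ z in 𝓝 w, f z = 0) {z : E} (hz : z ∈ Metric.ball c r) : f z = 0 := by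
  -- Restriction to the complex line through w and z reduces to one variable; the parameters landing
  -- in the ball form a convex set.
  set l : ℂ → E := fun s => w + s • (z - w) with hl
  have hlc : Continuous l := by fun_prop
  set S : Set ℂ := l ⁻¹' Metric.ball c r
  have hconv : Convex ℝ S := by
    intro s hs t ht p q hp hq hpq
    have : l (p • s + q • t) = p • l s + q • l t := by
      simp only [hl, add_smul, smul_add, smul_assoc]
      rw [add_add_add_comm, ← add_smul, hpq, one_smul]
    simpa only [S, Set.mem_preimage, this] using convex_ball c r hs ht hp hq hpq
  have hd : DifferentiableOn ℂ (fun s => f (l s)) S :=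
    hf.comp (g := f) (by fun_prop) fun s hs => hs
  have han := hd.analyticOnNhd (Metric.isOpen_ball.preimage hlc)
  have h0S : (0 : ℂ) ∈ S := by simpa [S, hl] using hw
  have h1S : (1 : ℂ) ∈ S := by simpa [S, hl] using hz
  have := han.eqOn_zero_of_preconnected_of_eventuallyEq_zero hconv.isPreconnected h0S
    ((hlc.tendsto' 0 w (by simp [hl])).eventually h0) h1S
  simpa [hl] using this

variable {𝓗 : Type*} [NormedAddCommGroup 𝓗] [InnerProductSpace ℂ 𝓗] [CompleteSpace 𝓗]

open scoped InnerProductSpace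

/-- Polarization: an identity between sesquilinear expressions in holomorphic and antiholomorphic
vector-valued functions that holds on the diagonal holds off the diagonal. -/
theorem inner_eq_of_forall_diagonal {c : E} {r : ℝ} {a₁ a₂ b₁ b₂ : E → 𝓗}
    (ha₁ : ∀ f, DifferentiableOn ℂ (fun z => ⟪f, a₁ z⟫_ℂ) (Metric.ball c r))
    (ha₂ : ∀ f, DifferentiableOn ℂ (fun z => ⟪f, a₂ z⟫_ℂ) (Metric.ball c r))
    (hb₁ : ∀ f, DifferentiableOn ℂ (fun z => ⟪b₁ z, f⟫_ℂ) (Metric.ball c r))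
    (hb₂ : ∀ f, DifferentiableOn ℂ (fun z => ⟪b₂ z, f⟫_ℂ) (Metric.ball c r))
    (A : 𝓗 →L[ℂ] 𝓗) (hdiag : ∀ z ∈ Metric.ball c r, ⟪a₁ z, A (a₂ z)⟫_ℂ = ⟪b₂ z, A (b₁ z)⟫_ℂ)
    {z : E} (hz : z ∈ Metric.ball c (r / 2)) : ⟪a₁ z, A (a₂ c)⟫_ℂ = ⟪b₂ c, A (b₁ z)⟫_ℂ := by
  set l : ℂ → E := fun s => c + s • (z - c) with hl
  -- The parameter of `a₁` and `b₁` is conjugated so that all four families become holomorphic. `a₂`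
  -- and `b₁` sit in the linear slot, so they are viewed as functionals on the dual.
  set α₁ : ℂ → 𝓗 →L[ℂ] ℂ := fun s => innerSL ℂ (a₁ (l (conj s)))
  set β₂ : ℂ → 𝓗 →L[ℂ] ℂ := fun t => innerSL ℂ (b₂ (l t))
  set α₂ : ℂ → (𝓗 →L[ℂ] ℂ) →L[ℂ] ℂ := fun t => ContinuousLinearMap.apply ℂ ℂ (a₂ (l t))
  set β₁ : ℂ → (𝓗 →L[ℂ] ℂ) →L[ℂ] ℂ := fun s => ContinuousLinearMap.apply ℂ ℂ (b₁ (l (conj s)))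
  have hα₁ : DifferentiableOn ℂ α₁ (Metric.ball 0 2) := by
    refine DifferentiableOn.of_forall_apply Metric.isOpen_ball fun f => ?_
    refine ((ha₁ f).comp_line hz).conj_conj_ball.congr fun s _ => ?_
    simp [α₁, hl, inner_conj_symm]
  have hβ₂ : DifferentiableOn ℂ β₂ (Metric.ball 0 2) :=
    DifferentiableOn.of_forall_apply Metric.isOpen_ball fun f => (hb₂ f).comp_line hz
  have hα₂ : DifferentiableOn ℂ α₂ (Metric.ball 0 2) := by
    refine DifferentiableOn.of_forall_apply Metric.isOpen_ball fun φ => ?_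
    refine ((ha₂ ((InnerProductSpace.toDual ℂ 𝓗).symm φ)).comp_line hz).congr fun s _ => ?_
    simp [α₂, hl]
  have hβ₁ : DifferentiableOn ℂ β₁ (Metric.ball 0 2) := by
    refine DifferentiableOn.of_forall_apply Metric.isOpen_ball fun φ => ?_
    refine ((hb₁ ((InnerProductSpace.toDual ℂ 𝓗).symm φ)).comp_line hz).conj_conj_ball.congr
      fun s _ => ?_
    simp only [β₁, hl, inner_conj_symm]
    simp
  have hcomp : ∀ {α : ℂ → 𝓗 →L[ℂ] ℂ}, DifferentiableOn ℂ α (Metric.ball 0 2) →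
      DifferentiableOn ℂ (fun s => (α s).comp A) (Metric.ball 0 2) := fun hα =>
    hα.clm_comp (differentiableOn_const A)
  set G : ℂ × ℂ → ℂ := fun p => α₂ p.2 ((α₁ p.1).comp A) - β₁ p.1 ((β₂ p.2).comp A) with hG
  have hGd : DifferentiableOn ℂ G (Metric.ball 0 2 ×ˢ Metric.ball 0 2) := by
    refine ((hcomp hα₁).clm_apply_prod hα₂).sub ?_
    exact ((hcomp hβ₂).clm_apply_prod hβ₁).comp (g := fun p => β₁ p.2 ((β₂ p.1).comp A))
      (t := Metric.ball 0 2 ×ˢ Metric.ball 0 2) (f := Prod.swap)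
      (differentiable_snd.prodMk differentiable_fst).differentiableOn fun p hp => ⟨hp.2, hp.1⟩
  -- `G` vanishes for s = conj t because both arguments are then the same point of the line; its
  -- value at (1, 0) compares z with c.
  have := eq_zero_of_forall_conj_diagonal hGd fun s hs => by
    simpa [hG, α₁, α₂, β₁, β₂, sub_eq_zero] using hdiag _ (line_mem_ball hz hs)
  simpa [hG, α₁, α₂, β₁, β₂, hl, sub_eq_zero] using this

end Lines

/-! ### Commutativity from an anti-unitary correspondence -/

section Commutant

variable {𝓗 : Type*} [NormedAddCommGroup 𝓗] [InnerProductSpace ℂ 𝓗] [CompleteSpace 𝓗]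

open scoped InnerProductSpace

/-- If an algebra of operators is intertwined with its adjoints by an anti-isometric correspondence
of dense range, its self-adjoint elements commute. -/
theorem mul_comm_of_isSelfAdjoint_of_anti_pairing {X : Type*} {φ ψ : X → 𝓗} (hφ : DenseRange φ)
    {M : StarSubalgebra ℂ (𝓗 →L[ℂ] 𝓗)}
    (h : ∀ C ∈ M, ∀ p q, ⟪ψ p, C (ψ q)⟫_ℂ = ⟪φ q, C (φ p)⟫_ℂ)
    {A B : 𝓗 →L[ℂ] 𝓗} (hA : A ∈ M) (hB : B ∈ M) (hAs : IsSelfAdjoint A) (hBs : IsSelfAdjoint B) :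
    A * B = B * A := by
  have h1 : ∀ p q, ⟪ψ p, ψ q⟫_ℂ = ⟪φ q, φ p⟫_ℂ := fun p q => by simpa using h 1 (one_mem M) p q
  have hsa : ∀ {C : 𝓗 →L[ℂ] 𝓗}, IsSelfAdjoint C → ∀ u v, ⟪C u, v⟫_ℂ = ⟪u, C v⟫_ℂ := fun hC u v => by
    rw [← ContinuousLinearMap.adjoint_inner_right, hC.adjoint_eq]
  have hmul : ∀ (C C' : 𝓗 →L[ℂ] 𝓗) v, (C * C') v = C (C' v) := fun _ _ _ => rfl
  -- elements approximating `C (φ p)` also approximate `C (ψ p)`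
  have happrox : ∀ C ∈ M, IsSelfAdjoint C → ∀ p, ∃ u : ℕ → X,
      Filter.Tendsto (fun k => φ (u k)) Filter.atTop (𝓝 (C (φ p))) ∧
      Filter.Tendsto (fun k => ψ (u k)) Filter.atTop (𝓝 (C (ψ p))) := by
    intro C hC hCs p
    obtain ⟨y, hy, hyt⟩ := mem_closure_iff_seq_limit.1 (hφ (C (φ p)))
    choose u hu using hy
    obtain rfl : (fun k => φ (u k)) = y := funext hu
    refine ⟨u, hyt, ?_⟩
    rw [tendsto_iff_norm_sub_tendsto_zero] at hyt ⊢
    refine hyt.congr fun k => ?_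
    -- The squared distance expands into pairings with 1, C and C², all in `M`, so `h` transfers it
    -- from φ to ψ.
    have hsq : ∀ v, ⟪v - C (φ p), v - C (φ p)⟫_ℂ = ⟪v, v⟫_ℂ - ⟪v, C (φ p)⟫_ℂ - ⟪φ p, C v⟫_ℂ
        + ⟪φ p, (C * C) (φ p)⟫_ℂ := fun v => by
      simp only [inner_sub_left, inner_sub_right, hsa hCs, hmul]
      ring
    have hsq' : ∀ v, ⟪v - C (ψ p), v - C (ψ p)⟫_ℂ = ⟪v, v⟫_ℂ - ⟪v, C (ψ p)⟫_ℂ - ⟪ψ p, C v⟫_ℂ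
        + ⟪ψ p, (C * C) (ψ p)⟫_ℂ := fun v => by
      simp only [inner_sub_left, inner_sub_right, hsa hCs, hmul]
      ring
    have : ⟪φ (u k) - C (φ p), φ (u k) - C (φ p)⟫_ℂ = ⟪ψ (u k) - C (ψ p), ψ (u k) - C (ψ p)⟫_ℂ := by
      rw [hsq, hsq', h1, h C hC, h C hC, h _ (mul_mem hC hC)]
      ring
    rw [inner_self_eq_norm_sq_to_K, inner_self_eq_norm_sq_to_K] at this
    have h2 : ‖φ (u k) - C (φ p)‖ ^ 2 = ‖ψ (u k) - C (ψ p)‖ ^ 2 := by exact_mod_cast this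
    exact (pow_left_inj₀ (norm_nonneg _) (norm_nonneg _) two_ne_zero).1 h2
  have key : ∀ p q, ⟪φ q, (A * B) (φ p)⟫_ℂ = ⟪φ q, (B * A) (φ p)⟫_ℂ := by
    intro p q
    obtain ⟨u, hu, hu'⟩ := happrox A hA hAs p
    obtain ⟨v, hv, hv'⟩ := happrox B hB hBs q
    -- Limit of ⟪ψ (u k), ψ (v k)⟫ = ⟪φ (v k), φ (u k)⟫, which is the case C = 1.
    have e1 : ⟪A (ψ p), B (ψ q)⟫_ℂ = ⟪B (φ q), A (φ p)⟫_ℂ :=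
      tendsto_nhds_unique ((hu'.inner hv').congr fun k => h1 (u k) (v k)) (hv.inner hu)
    rw [← h _ (mul_mem hA hB), hmul, ← hsa hAs, e1, hsa hBs,
      hmul]
  have : ⇑(A * B) = ⇑(B * A) := by
    refine (A * B).continuous.ext_on hφ (B * A).continuous ?_
    rintro _ ⟨p, rfl⟩
    refine hφ.eq_of_inner_right (𝕜 := ℂ) ?_
    intro q
    exact key p q
  exact DFunLike.coe_injective this

-- `M` is star-closed, so real and imaginary parts of its elements stay in `M`, and the self-adjoint
-- case extends by bilinearity.
open Complex in
theorem mul_comm_of_anti_pairing {X : Type*} {φ ψ : X → 𝓗} (hφ : DenseRange φ)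
    {M : StarSubalgebra ℂ (𝓗 →L[ℂ] 𝓗)}
    (h : ∀ C ∈ M, ∀ p q, ⟪ψ p, C (ψ q)⟫_ℂ = ⟪φ q, C (φ p)⟫_ℂ)
    {A B : 𝓗 →L[ℂ] 𝓗} (hA : A ∈ M) (hB : B ∈ M) : A * B = B * A := by
  have hre : ∀ C ∈ M, (realPart C : 𝓗 →L[ℂ] 𝓗) ∈ M := fun C hC => by
    rw [realPart_apply_coe, ← Complex.coe_smul]
    exact M.smul_mem (add_mem hC (star_mem hC)) _
  have him : ∀ C ∈ M, (imaginaryPart C : 𝓗 →L[ℂ] 𝓗) ∈ M := fun C hC => by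
    rw [imaginaryPart_apply_coe, ← Complex.coe_smul]
    exact M.smul_mem (M.smul_mem (sub_mem hC (star_mem hC)) _) _
  have hc : ∀ {C C' : selfAdjoint (𝓗 →L[ℂ] 𝓗)}, (C : 𝓗 →L[ℂ] 𝓗) ∈ M → (C' : 𝓗 →L[ℂ] 𝓗) ∈ M →
      Commute (C : 𝓗 →L[ℂ] 𝓗) C' := fun hC hC' =>
    mul_comm_of_isSelfAdjoint_of_anti_pairing hφ h hC hC' (Subtype.prop _) (Subtype.prop _)
  rw [← realPart_add_I_smul_imaginaryPart A, ← realPart_add_I_smul_imaginaryPart B]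
  have e1 := hc (hre A hA) (hre B hB)
  have e2 := hc (hre A hA) (him B hB)
  have e3 := hc (him A hA) (hre B hB)
  have e4 := hc (him A hA) (him B hB)
  exact ((e1.add_right (e2.smul_right I)).add_left
    ((e3.smul_left I).add_right ((e4.smul_right I).smul_left I))).eq

/-- Variant of `mul_comm_of_anti_pairing` for the conjugate-linear extension of a correspondence
between a family of dense span and another family. -/
theorem mul_comm_of_anti_pairing_of_span {ι : Type*} {S S' : ι → 𝓗}
    (hS : (Submodule.span ℂ (Set.range S)).topologicalClosure = ⊤)
    {M : StarSubalgebra ℂ (𝓗 →L[ℂ] 𝓗)}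
    (h : ∀ C ∈ M, ∀ i j, ⟪S' i, C (S' j)⟫_ℂ = ⟪S j, C (S i)⟫_ℂ)
    {A B : 𝓗 →L[ℂ] 𝓗} (hA : A ∈ M) (hB : B ∈ M) : A * B = B * A := by
  refine mul_comm_of_anti_pairing (X := ι →₀ ℂ) (φ := Finsupp.linearCombination ℂ S)
    (ψ := fun p => p.sum fun i c => conj c • S' i) ?_ (M := M) ?_ hA hB
  · rw [DenseRange, ← LinearMap.coe_range, Finsupp.range_linearCombination,
      Submodule.dense_iff_topologicalClosure_eq_top]
    exact hS
  · intro C hC p q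
    simp only [Finsupp.linearCombination_apply, Finsupp.sum, map_sum, map_smul, sum_inner,
      inner_sum, inner_smul_left, inner_smul_right, Complex.conj_conj, h C hC]
    simp only [Finset.mul_sum]
    rw [Finset.sum_comm]
    simp only [mul_left_comm]

end Commutant

/-! ### Holomorphic and antiholomorphic maps of manifolds -/

section Holomorphic

variable {E : Type*} [NormedAddCommGroup E] [NormedSpace ℂ E]
  {E' : Type*} [NormedAddCommGroup E'] [NormedSpace ℂ E']
  {E'' : Type*} [NormedAddCommGroup E''] [NormedSpace ℂ E'']
  [NormedSpace ℝ E] [NormedSpace ℝ E'] [NormedSpace ℝ E'']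
  {X : Type*} [TopologicalSpace X] {I : ModelWithCorners ℝ E X}
  {X' : Type*} [TopologicalSpace X'] {J : ModelWithCorners ℝ E' X'}
  {X'' : Type*} [TopologicalSpace X''] {K : ModelWithCorners ℝ E'' X''}
  {M : Type*} [TopologicalSpace M] [ChartedSpace X M]
  {M' : Type*} [TopologicalSpace M'] [ChartedSpace X' M']
  {M'' : Type*} [TopologicalSpace M''] [ChartedSpace X'' M'']

/-- Real differentiability at a point with complex-linear differential. -/
def HolomorphicAt (I : ModelWithCorners ℝ E X) (J : ModelWithCorners ℝ E' X') (f : M → M')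
    (x : M) : Prop :=
  ∃ A : E →L[ℝ] E', HasMFDerivAt I J f x A ∧ ∀ v, A (Complex.I • v) = Complex.I • A v

/-- Real differentiability at a point with conjugate-linear differential. -/
def AntiholomorphicAt (I : ModelWithCorners ℝ E X) (J : ModelWithCorners ℝ E' X') (f : M → M')
    (x : M) : Prop :=
  ∃ A : E →L[ℝ] E', HasMFDerivAt I J f x A ∧ ∀ v, A (Complex.I • v) = -(Complex.I • A v)

theorem HolomorphicAt.comp_antiholomorphicAt {g : M' → M''} {f : M → M'} {x : M}
    (hg : HolomorphicAt J K g (f x)) (hf : AntiholomorphicAt I J f x) :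
    AntiholomorphicAt I K (g ∘ f) x := by
  obtain ⟨B, hB, hB'⟩ := hg
  obtain ⟨A, hA, hA'⟩ := hf
  exact ⟨B.comp A, hB.comp x hA, fun v => by simp [hA', hB']⟩

theorem AntiholomorphicAt.comp_holomorphicAt {g : M' → M''} {f : M → M'} {x : M}
    (hg : AntiholomorphicAt J K g (f x)) (hf : HolomorphicAt I J f x) :
    AntiholomorphicAt I K (g ∘ f) x := by
  obtain ⟨B, hB, hB'⟩ := hg
  obtain ⟨A, hA, hA'⟩ := hf
  exact ⟨B.comp A, hB.comp x hA, fun v => by simp [hA', hB']⟩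

theorem HolomorphicAt.comp {g : M' → M''} {f : M → M'} {x : M}
    (hg : HolomorphicAt J K g (f x)) (hf : HolomorphicAt I J f x) :
    HolomorphicAt I K (g ∘ f) x := by
  obtain ⟨B, hB, hB'⟩ := hg
  obtain ⟨A, hA, hA'⟩ := hf
  exact ⟨B.comp A, hB.comp x hA, fun v => by simp [hA', hB']⟩

/-- Complex differentiability implies real differentiability, when the real models underlie the
complex ones. -/
theorem MDifferentiableAt.holomorphicAt [IsScalarTower ℝ ℂ E] [IsScalarTower ℝ ℂ E']
    {I₀ : ModelWithCorners ℂ E X}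
    {J₀ : ModelWithCorners ℂ E' X'} {f : M → M'} {x : M} (h : MDifferentiableAt I₀ J₀ f x)
    (hI : I₀.toPartialEquiv = I.toPartialEquiv := by rfl)
    (hJ : J₀.toPartialEquiv = J.toPartialEquiv := by rfl) : HolomorphicAt I J f x := by
  obtain ⟨A, hA⟩ : ∃ A : E →L[ℂ] E', HasMFDerivAt I₀ J₀ f x A := ⟨_, h.hasMFDerivAt⟩
  refine ⟨A.restrictScalars ℝ, ⟨hA.1, ?_⟩, fun v => by simp⟩
  have h2 := HasFDerivWithinAt.restrictScalars ℝ (f' := A) hA.2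
  -- The complex and real models have the same underlying charts, so the derivative in coordinates
  -- is the same one with restricted scalars.
  have e1 : (extChartAt I₀ x) = extChartAt I x := by
    simp only [extChartAt, OpenPartialHomeomorph.extend, hI]
  have e2 : (extChartAt J₀ (f x)) = extChartAt J (f x) := by
    simp only [extChartAt, OpenPartialHomeomorph.extend, hJ]
  have e3 : Set.range I₀ = Set.range I := by
    rw [← ModelWithCorners.target_eq, ← ModelWithCorners.target_eq, hI]
  simp only [writtenInExtChartAt, e1, e2, e3] at h2 ⊢
  exact h2

end Holomorphic

section Vector

variable {E : Type*} [NormedAddCommGroup E] [NormedSpace ℂ E]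

theorem AntiholomorphicAt.differentiableAt_conj {f : E → ℂ} {z : E}
    (hf : AntiholomorphicAt 𝓘(ℝ, E) 𝓘(ℝ, ℂ) f z) : DifferentiableAt ℂ (fun w => conj (f w)) z := by
  obtain ⟨A, hA, hA'⟩ := hf
  have h1 : HasFDerivAt f A z := hA.hasFDerivAt
  have h2 : HasFDerivAt (fun w => conj (f w)) (Complex.conjCLE.toContinuousLinearMap.comp A) z :=
    Complex.conjCLE.toContinuousLinearMap.hasFDerivAt.comp z h1
  set B : E →L[ℝ] ℂ := Complex.conjCLE.toContinuousLinearMap.comp A with hB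
  have hBI : ∀ v, B (Complex.I • v) = Complex.I • B v := fun v => by simp [hB, hA']
  have hBc : ∀ (c : ℂ) v, B (c • v) = c • B v := by
    intro c v
    conv_lhs => rw [← Complex.re_add_im c, add_smul, mul_smul, Complex.coe_smul, Complex.coe_smul,
      map_add, map_smul, map_smul, hBI]
    conv_rhs => rw [← Complex.re_add_im c, add_smul, mul_smul, Complex.coe_smul, Complex.coe_smul]
  let B' : E →L[ℂ] ℂ := ⟨⟨⟨B, map_add B⟩, hBc⟩, B.continuous⟩
  exact (hasFDerivAt_of_restrictScalars ℝ (f' := B') h2 rfl).differentiableAt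

end Vector

/-! ### Local coordinates adapted to σ -/

section Base

variable {E : Type*} [NormedAddCommGroup E] [NormedSpace ℂ E]
  {D : Type*} [TopologicalSpace D] [ChartedSpace E D]
  {F : Type*} [NormedAddCommGroup F] [NormedSpace ℂ F]
  {V : D → Type*} [TopologicalSpace (Bundle.TotalSpace F V)]
  [∀ x, NormedAddCommGroup (V x)] [∀ x, InnerProductSpace ℂ (V x)]
  [FiberBundle F V] (σ : AntiholomorphicBundleEnd E F V)

namespace AntiholomorphicBundleEnd

theorem continuous_base : Continuous σ.base :=
  continuous_iff_continuousAt.2 fun x => (σ.isAntiholomorphic_base x).choose_spec.1.continuousAt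

/-- In the preferred chart at `x` there is a ball whose image under `σ` lies in a trivializing
neighbourhood. -/
theorem exists_ball_subset (x : D) : ∃ r > 0, ∀ z ∈ Metric.ball (chartAt E x x) r,
    z ∈ (chartAt E x).target ∧
      σ.base ((chartAt E x).symm z) ∈ (trivializationAt F V (σ.base x)).baseSet := by
  have h1 : ∀ᶠ z in 𝓝 (chartAt E x x), z ∈ (chartAt E x).target := chart_target_mem_nhds E x
  have h2 : ∀ᶠ z in 𝓝 (chartAt E x x),
      σ.base ((chartAt E x).symm z) ∈ (trivializationAt F V (σ.base x)).baseSet := by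
    have hc : ContinuousAt (σ.base ∘ (chartAt E x).symm) (chartAt E x x) :=
      σ.continuous_base.continuousAt.comp
        ((chartAt E x).continuousAt_symm (mem_chart_target E x))
    refine hc.eventually_mem ?_
    simp only [Function.comp_apply, (chartAt E x).left_inv (mem_chart_source E x)]
    exact (trivializationAt F V (σ.base x)).open_baseSet.mem_nhds
      (FiberBundle.mem_baseSet_trivializationAt' _)
  obtain ⟨r, hr, h⟩ := Metric.eventually_nhds_iff_ball.1 (h1.and h2)
  exact ⟨r, hr, h⟩

end AntiholomorphicBundleEnd

end Base

/-! ### Local holomorphic functions attached to sections and σ -/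

section Bundle

variable {E : Type*} [NormedAddCommGroup E] [NormedSpace ℂ E]
  {D : Type*} [TopologicalSpace D] [ChartedSpace E D]
  {F : Type*} [NormedAddCommGroup F] [NormedSpace ℂ F]
  {V : D → Type*} [TopologicalSpace (Bundle.TotalSpace F V)]
  [∀ x, NormedAddCommGroup (V x)] [∀ x, InnerProductSpace ℂ (V x)]
  [FiberBundle F V] [VectorBundle ℂ F V]

theorem holomorphicAt_chart_symm [IsManifold 𝓘(ℂ, E) ω D] (x : D) {z : E}
    (hz : z ∈ (chartAt E x).target) :
    HolomorphicAt 𝓘(ℝ, E) 𝓘(ℝ, E) (chartAt E x).symm z :=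
  ((contMDiffOn_chart_symm (I := 𝓘(ℂ, E)) (n := ω) (x := x)).contMDiffAt
    ((chartAt E x).open_target.mem_nhds hz) |>.mdifferentiableAt (by simp)).holomorphicAt

theorem ContMDiffSection.holomorphicAt (s : HolomorphicSection E F V) (x : D) :
    HolomorphicAt 𝓘(ℝ, E) (𝓘(ℝ, E).prod 𝓘(ℝ, F))
      (fun x => (⟨x, s x⟩ : Bundle.TotalSpace F V)) x :=
  (s.contMDiff.mdifferentiableAt (by simp)).holomorphicAt

variable [ContMDiffVectorBundle ω F V 𝓘(ℂ, E)]

theorem holomorphicAt_trivialization_snd (e : Bundle.Trivialization F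
      (Bundle.TotalSpace.proj : Bundle.TotalSpace F V → D)) [MemTrivializationAtlas e]
    {p : Bundle.TotalSpace F V} (hp : p.1 ∈ e.baseSet) (l : F →L[ℂ] ℂ) :
    HolomorphicAt (𝓘(ℝ, E).prod 𝓘(ℝ, F)) 𝓘(ℝ, ℂ)
      (fun p : Bundle.TotalSpace F V => l (e p).2) p := by
  have h1 : ContMDiffAt (𝓘(ℂ, E).prod 𝓘(ℂ, F)) (𝓘(ℂ, E).prod 𝓘(ℂ, F)) ω e p :=
    (Bundle.Trivialization.contMDiffOn (IB := 𝓘(ℂ, E)) (n := ω) e).contMDiffAt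
      (e.open_source.mem_nhds (e.mem_source.2 hp))
  have h2 : ContMDiffAt (𝓘(ℂ, E).prod 𝓘(ℂ, F)) 𝓘(ℂ, ℂ) ω
      (fun p : Bundle.TotalSpace F V => l (e p).2) p :=
    l.contMDiff.contMDiffAt.comp p (contMDiffAt_snd.comp p h1)
  exact (h2.mdifferentiableAt (by simp)).holomorphicAt

variable [IsManifold 𝓘(ℂ, E) ω D]

namespace AntiholomorphicBundleEnd

variable (σ : AntiholomorphicBundleEnd E F V) (s : HolomorphicSection E F V)
  (e : Bundle.Trivialization F (Bundle.TotalSpace.proj : Bundle.TotalSpace F V → D))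
  [MemTrivializationAtlas e] (l : F →L[ℂ] ℂ) (x : D) {z : E}

/-- Chart inverse, section and trivialization are holomorphic and σ enters once, so the composite is
antiholomorphic; the outer conjugation makes it holomorphic. -/
theorem differentiableAt_section_base (hz : z ∈ (chartAt E x).target)
    (hze : σ.base ((chartAt E x).symm z) ∈ e.baseSet) :
    DifferentiableAt ℂ (fun z => conj (l (e ⟨σ.base ((chartAt E x).symm z),
      s (σ.base ((chartAt E x).symm z))⟩).2)) z := by
  refine AntiholomorphicAt.differentiableAt_conj ?_
  have h1 : AntiholomorphicAt 𝓘(ℝ, E) 𝓘(ℝ, E) (σ.base ∘ (chartAt E x).symm) z :=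
    AntiholomorphicAt.comp_holomorphicAt (σ.isAntiholomorphic_base _)
      (holomorphicAt_chart_symm x hz)
  have h2 := (s.holomorphicAt (σ.base ((chartAt E x).symm z))).comp_antiholomorphicAt
    (f := σ.base ∘ (chartAt E x).symm) (x := z) h1
  exact (holomorphicAt_trivialization_snd e hze l).comp_antiholomorphicAt
    (f := (fun x => (⟨x, s x⟩ : Bundle.TotalSpace F V)) ∘ (σ.base ∘ (chartAt E x).symm)) (x := z) h2

theorem differentiableAt_total_section (hz : z ∈ (chartAt E x).target)
    (hze : σ.base ((chartAt E x).symm z) ∈ e.baseSet) :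
    DifferentiableAt ℂ (fun z => conj (l (e (σ.total ⟨(chartAt E x).symm z,
      s ((chartAt E x).symm z)⟩)).2)) z := by
  refine AntiholomorphicAt.differentiableAt_conj ?_
  have h1 := (s.holomorphicAt ((chartAt E x).symm z)).comp (x := z)
    (holomorphicAt_chart_symm x hz)
  have h2 : AntiholomorphicAt 𝓘(ℝ, E) (𝓘(ℝ, E).prod 𝓘(ℝ, F))
      (σ.total ∘ (fun x => (⟨x, s x⟩ : Bundle.TotalSpace F V)) ∘ (chartAt E x).symm) z :=
    AntiholomorphicAt.comp_holomorphicAt (σ.isAntiholomorphic_total _) h1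
  exact (holomorphicAt_trivialization_snd e
    (p := σ.total ⟨(chartAt E x).symm z, s ((chartAt E x).symm z)⟩) hze l).comp_antiholomorphicAt
    (f := σ.total ∘ (fun x => (⟨x, s x⟩ : Bundle.TotalSpace F V)) ∘ (chartAt E x).symm) (x := z) h2

end AntiholomorphicBundleEnd

end Bundle

/-! ### Schur's lemma and anti-unitary operators on a fiber -/

section MultiplicityFree

variable {G : Type*} [Group G] {𝓥 : Type*} [NormedAddCommGroup 𝓥] [InnerProductSpace ℂ 𝓥]

open scoped InnerProductSpace

/-- A semilinear isometry for complex conjugation is anti-unitary. -/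
theorem inner_map_map_of_conj {𝓦 : Type*} [NormedAddCommGroup 𝓦] [InnerProductSpace ℂ 𝓦]
    (τ : 𝓥 ≃ₛₗᵢ[starRingEnd ℂ] 𝓦) (u v : 𝓥) : ⟪τ u, τ v⟫_ℂ = ⟪v, u⟫_ℂ := by
  have hI : Complex.I • τ v = -τ (Complex.I • v) := by
    rw [τ.map_smulₛₗ, Complex.conj_I, neg_smul, neg_neg]
  have hI' : RCLike.I • τ v = -τ ((RCLike.I : ℂ) • v) := hI
  rw [inner_eq_sum_norm_sq_div_four, ← inner_conj_symm v u, inner_eq_sum_norm_sq_div_four u v, hI']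
  simp only [← sub_eq_add_neg, sub_neg_eq_add, ← map_add, ← map_sub, LinearIsometryEquiv.norm_map]
  simp only [RCLike.I_to_complex, map_div₀, map_add, map_sub, map_mul, map_pow,
    Complex.conj_ofReal, Complex.conj_I, map_ofNat, Complex.coe_algebraMap]
  ring

/-- The canonical projections of an internal direct sum. -/
theorem DirectSum.IsInternal.exists_projection {ι : Type*} [DecidableEq ι] {W : ι → Submodule ℂ 𝓥}
    (hW : DirectSum.IsInternal W) (i : ι) : ∃ P : 𝓥 →ₗ[ℂ] 𝓥, (∀ v, P v ∈ W i) ∧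
      (∀ v ∈ W i, P v = v) ∧ ∀ j ≠ i, ∀ v ∈ W j, P v = 0 := by
  let e := LinearEquiv.ofBijective (DirectSum.coeLinearMap W) hW
  have he : ∀ j (v : W j), e.symm v = DirectSum.lof ℂ ι (fun j => W j) j v := fun j v => by
    rw [LinearEquiv.symm_apply_eq]
    exact (DirectSum.coeLinearMap_lof W j v).symm
  refine ⟨(W i).subtype ∘ₗ DirectSum.component ℂ ι _ i ∘ₗ e.symm.toLinearMap, fun v => by simp,
    fun v hv => ?_, fun j hj v hv => ?_⟩
  · have := he i ⟨v, hv⟩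
    simp only at this
    simp [this, DirectSum.component.lof_self]
  · have := he j ⟨v, hv⟩
    simp only at this
    simp [this, DirectSum.component.of, hj]

theorem DirectSum.IsInternal.induction {ι : Type*} [DecidableEq ι] {W : ι → Submodule ℂ 𝓥}
    (hW : DirectSum.IsInternal W) {p : 𝓥 → Prop} (v : 𝓥) (hmem : ∀ i, ∀ v ∈ W i, p v) (h0 : p 0)
    (hadd : ∀ u v, p u → p v → p (u + v)) : p v :=
  Submodule.iSup_induction W (motive := p) (hW.submodule_iSup_eq_top ▸ Submodule.mem_top : v ∈ iSup W)
    hmem h0 hadd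

variable {ρ : G →* (𝓥 ≃ₗᵢ[ℂ] 𝓥)} {ι : Type*} [DecidableEq ι]
  {W : ι → Subrepresentation (unitaryToRepresentation ρ)} [FiniteDimensional ℂ 𝓥]

/-- The projections onto the irreducible constituents are intertwining operators. -/
theorem IsIrreducibleDecomposition.exists_projection (hW : IsIrreducibleDecomposition W) (i : ι) :
    ∃ P : 𝓥 →L[ℂ] 𝓥, (∀ v, P v ∈ (W i).toSubmodule) ∧ (∀ v ∈ (W i).toSubmodule, P v = v) ∧
      (∀ j ≠ i, ∀ v ∈ (W j).toSubmodule, P v = 0) ∧ ∀ g v, P (ρ g v) = ρ g (P v) := by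
  obtain ⟨P, h1, h2, h3⟩ := hW.isInternal.exists_projection i
  refine ⟨LinearMap.toContinuousLinearMap P, h1, h2, h3, fun g v => ?_⟩
  refine hW.isInternal.induction (p := fun v => P (ρ g v) = ρ g (P v)) v (fun j v hv => ?_)
    (by simp) fun u v hu hv => by simp only [map_add, hu, hv]
  have hgv : ρ g v ∈ (W j).toSubmodule := (W j).apply_mem_toSubmodule g hv
  rcases eq_or_ne j i with rfl | hj
  · simp [h2 v hv, h2 _ hgv]
  · simp [h3 j hj v hv, h3 j hj _ hgv]

/-- **Schur's lemma** for multiplicity-free representations. -/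
theorem IsMultiplicityFree.exists_eq_smul (hρ : IsMultiplicityFree ρ)
    (hW : IsIrreducibleDecomposition W) {K : 𝓥 →L[ℂ] 𝓥} (hK : ∀ g v, K (ρ g v) = ρ g (K v))
    (i : ι) : ∃ c : ℂ, ∀ v ∈ (W i).toSubmodule, K v = c • v := by
  obtain ⟨P, h1, h2, h3, hP⟩ := hW.exists_projection i
  have hmem : ∀ v ∈ (W i).toSubmodule, K v ∈ (W i).toSubmodule := fun v hv => by
    -- Commuting with the projection gives K v = P (K v), so K preserves `W i`.
    have := congr($(hρ K P hK hP) v)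
    simp only [ContinuousLinearMap.comp_apply, h2 v hv] at this
    exact this ▸ h1 _
  have := hW.irreducible i
  let f : Representation.IntertwiningMap (W i).toRepresentation (W i).toRepresentation :=
    LinearMap.intertwiningMap_of_isIntertwiningMap _ _ ((K : 𝓥 →ₗ[ℂ] 𝓥).restrict hmem)
      fun g v => Subtype.ext (hK g v)
  obtain ⟨c, hc⟩ :=
    (Representation.IsIrreducible.algebraMap_intertwiningMap_bijective_of_isAlgClosed
      (ρ := (W i).toRepresentation)).2 f
  refine ⟨c, fun v hv => ?_⟩
  have := congr(($hc ⟨v, hv⟩ : 𝓥))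
  exact this.symm

theorem adjoint_intertwines {K : 𝓥 →L[ℂ] 𝓥} (hK : ∀ g v, K (ρ g v) = ρ g (K v)) (g : G) (v : 𝓥) :
    haveI := FiniteDimensional.complete ℂ 𝓥
    K.adjoint (ρ g v) = ρ g (K.adjoint v) := by
  have := FiniteDimensional.complete ℂ 𝓥
  refine ext_inner_left ℂ fun w => ?_
  have hw : w = ρ g (ρ g⁻¹ w) := by
    have := congr($(map_mul ρ g g⁻¹) w)
    rw [mul_inv_cancel, map_one] at this
    exact this
  rw [ContinuousLinearMap.adjoint_inner_right, hw, hK, LinearIsometryEquiv.inner_map_map,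
    LinearIsometryEquiv.inner_map_map, ContinuousLinearMap.adjoint_inner_right]

/-- The adjoint of the projection P onto `W i` also intertwines, hence is a scalar c on `W j`; then
‖P* v‖² = ⟪v, P (c v)⟫ = 0. -/
theorem IsMultiplicityFree.inner_eq_zero (hρ : IsMultiplicityFree ρ)
    (hW : IsIrreducibleDecomposition W) {i j : ι} (hij : i ≠ j) {u v : 𝓥}
    (hu : u ∈ (W i).toSubmodule) (hv : v ∈ (W j).toSubmodule) : ⟪u, v⟫_ℂ = 0 := by
  have := FiniteDimensional.complete ℂ 𝓥
  obtain ⟨P, h1, h2, h3, hP⟩ := hW.exists_projection i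
  obtain ⟨c, hc⟩ := hρ.exists_eq_smul hW (adjoint_intertwines hP) j
  have h0 : P.adjoint v = 0 := by
    rw [← inner_self_eq_zero (𝕜 := ℂ), ContinuousLinearMap.adjoint_inner_left, hc v hv, map_smul,
      h3 j hij.symm v hv]
    simp
  rw [← h2 u hu, ← ContinuousLinearMap.adjoint_inner_right, h0, inner_zero_right]

/-- An anti-unitary operator preserving the irreducible constituents of a multiplicity-free
representation conjugates every intertwining operator to its adjoint. -/
theorem IsMultiplicityFree.inner_conj_eq (hρ : IsMultiplicityFree ρ)
    (hW : IsIrreducibleDecomposition W) {K : 𝓥 →L[ℂ] 𝓥} (hK : ∀ g v, K (ρ g v) = ρ g (K v))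
    (τ : 𝓥 ≃ₛₗᵢ[starRingEnd ℂ] 𝓥) (hτ : ∀ i, ∀ v ∈ (W i).toSubmodule, τ v ∈ (W i).toSubmodule)
    (u v : 𝓥) : ⟪τ u, K (τ v)⟫_ℂ = ⟪v, K u⟫_ℂ := by
  refine hW.isInternal.induction (p := fun u => ⟪τ u, K (τ v)⟫_ℂ = ⟪v, K u⟫_ℂ) u
    (fun i u hu => ?_) (by simp) fun u u' hu hu' => by
    simp only [map_add, inner_add_left, inner_add_right, hu, hu']
  refine hW.isInternal.induction (p := fun v => ⟪τ u, K (τ v)⟫_ℂ = ⟪v, K u⟫_ℂ) v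
    (fun j v hv => ?_) (by simp) fun v v' hv hv' => by
    simp only [map_add, inner_add_left, inner_add_right, hv, hv']
  obtain ⟨c, hc⟩ := hρ.exists_eq_smul hW hK i
  obtain ⟨d, hd⟩ := hρ.exists_eq_smul hW hK j
  rw [hc u hu, hd _ (hτ j v hv), inner_smul_right, inner_smul_right]
  rcases eq_or_ne i j with rfl | hij
  · rw [inner_map_map_of_conj]
    rcases eq_or_ne u 0 with rfl | hu0
    · simp
    · have : c • u = d • u := (hc u hu).symm.trans (hd u hu)
      rw [smul_left_injective ℂ hu0 this]
  · rw [hρ.inner_eq_zero hW hij (hτ i u hu) (hτ j v hv), hρ.inner_eq_zero hW hij.symm hv hu]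
    simp

end MultiplicityFree

/-! ### Coherent vectors and spreading from the diagonal -/

section Realization

variable {E : Type*} [NormedAddCommGroup E] [NormedSpace ℂ E]
  {D : Type*} [TopologicalSpace D] [ChartedSpace E D]
  {F : Type*} [NormedAddCommGroup F] [NormedSpace ℂ F]
  {V : D → Type*} [TopologicalSpace (Bundle.TotalSpace F V)]
  [∀ x, NormedAddCommGroup (V x)] [∀ x, InnerProductSpace ℂ (V x)]
  [FiberBundle F V] [VectorBundle ℂ F V]

open scoped InnerProductSpace

variable (F V) in
theorem VectorBundle.finiteDimensional_fiber [FiniteDimensional ℂ F] (x : D) :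
    FiniteDimensional ℂ (V x) :=
  ((trivializationAt F V x).continuousLinearEquivAt ℂ x
    (FiberBundle.mem_baseSet_trivializationAt' x)).symm.toLinearEquiv.finiteDimensional

theorem Bundle.Trivialization.eq_of_forall_dual
    (e : Bundle.Trivialization F (Bundle.TotalSpace.proj : Bundle.TotalSpace F V → D))
    [MemTrivializationAtlas e] {x : D} (hx : x ∈ e.baseSet) {u v : V x}
    (h : ∀ l : F →L[ℂ] ℂ, l (e ⟨x, u⟩).2 = l (e ⟨x, v⟩).2) : u = v := by
  have : (e ⟨x, u⟩).2 = (e ⟨x, v⟩).2 := (SeparatingDual.eq_iff_forall_dual_eq (R := ℂ)).2 h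
  exact (e.continuousLinearEquivAt ℂ x hx).injective this

section Evaluation

variable {𝓗 : Type*} [NormedAddCommGroup 𝓗] [InnerProductSpace ℂ 𝓗]

/-- Evaluation at a point, as a continuous functional on a realized representation. -/
def evalCLM (T : 𝓗 →ₗ[ℂ] HolomorphicSection E F V)
    (hT : Continuous[inferInstance, compactConvergence E F V] T) (x : D) : 𝓗 →L[ℂ] V x where
  toFun f := T f x
  map_add' f g := by simp
  map_smul' c f := by simp
  cont := by
    rw [Metric.continuous_iff']
    intro f ε hε
    have hopen : IsOpen (T ⁻¹' {t : HolomorphicSection E F V | ∀ y ∈ ({x} : Set D),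
        ‖t y - T f y‖ < ε}) :=
      continuous_generateFrom_iff.1 hT _ ⟨T f, {x}, ε, isCompact_singleton, hε, rfl⟩
    filter_upwards [hopen.mem_nhds (by simpa using hε)] with g hg
    simpa [dist_eq_norm] using hg

@[simp]
theorem evalCLM_apply (T : 𝓗 →ₗ[ℂ] HolomorphicSection E F V)
    (hT : Continuous[inferInstance, compactConvergence E F V] T) (x : D) (f : 𝓗) :
    evalCLM T hT x f = T f x := rfl

variable [CompleteSpace 𝓗]

/-- The vector representing the functional `f ↦ ⟪p.2, (T f) p.1⟫_ℂ`. -/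
def coherentVector (T : 𝓗 →ₗ[ℂ] HolomorphicSection E F V)
    (hT : Continuous[inferInstance, compactConvergence E F V] T) (p : Bundle.TotalSpace F V) : 𝓗 :=
  (InnerProductSpace.toDual ℂ 𝓗).symm ((innerSL ℂ p.2).comp (evalCLM T hT p.1))

variable {T : 𝓗 →ₗ[ℂ] HolomorphicSection E F V}
  {hT : Continuous[inferInstance, compactConvergence E F V] T}

theorem inner_coherentVector (p : Bundle.TotalSpace F V) (f : 𝓗) :
    ⟪coherentVector T hT p, f⟫_ℂ = ⟪p.2, T f p.1⟫_ℂ := by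
  simp [coherentVector]

/-- If f is orthogonal to all coherent vectors, pairing with the one at (x, T f x) gives ‖T f x‖² =
0. -/
theorem span_coherentVector (hinj : Function.Injective T) :
    (Submodule.span ℂ (Set.range (coherentVector T hT))).topologicalClosure = ⊤ := by
  rw [Submodule.topologicalClosure_eq_top_iff, Submodule.eq_bot_iff]
  intro f hf
  rw [Submodule.mem_orthogonal] at hf
  refine hinj ?_
  rw [map_zero]
  refine ContMDiffSection.ext fun x => ?_
  have := hf _ (Submodule.subset_span ⟨⟨x, T f x⟩, rfl⟩)
  rw [inner_coherentVector] at this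
  simpa using this

end Evaluation

variable [ContMDiffVectorBundle ω F V 𝓘(ℂ, E)] [IsManifold 𝓘(ℂ, E) ω D]

namespace AntiholomorphicBundleEnd

variable (σ : AntiholomorphicBundleEnd E F V)

/-- The identity theorem for holomorphic sections related by `σ`. -/
theorem section_eq_of_eventually [ConnectedSpace D] {s t : HolomorphicSection E F V} {x₀ : D}
    (h : ∀ᶠ y in 𝓝 x₀, s (σ.base y) = σ.fiber y (t y)) (y : D) :
    s (σ.base y) = σ.fiber y (t y) := by
  set S : Set D := {y | s (σ.base y) = σ.fiber y (t y)}
  suffices hS : interior S = Set.univ by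
    have hy : y ∈ interior S := hS ▸ Set.mem_univ y
    exact (interior_subset hy : y ∈ S)
  -- The interior is open by construction; closedness comes from the identity theorem on a ball
  -- around a limit point.
  refine IsClopen.eq_univ ⟨?_, isOpen_interior⟩ ⟨x₀, mem_interior_iff_mem_nhds.2 h⟩
  refine isClosed_of_closure_subset fun x hx => ?_
  obtain ⟨r, hr, hball⟩ := σ.exists_ball_subset x
  set χ := chartAt E x
  set e := trivializationAt F V (σ.base x)
  have hN : χ.source ∩ χ ⁻¹' Metric.ball (χ x) r ∈ 𝓝 x :=
    (χ.continuousAt (mem_chart_source E x)).preimage_mem_nhds (Metric.ball_mem_nhds _ hr) |>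
      Filter.inter_mem (χ.open_source.mem_nhds (mem_chart_source E x))
  obtain ⟨w, ⟨hws, hwb⟩, hwS⟩ := mem_closure_iff_nhds.1 hx _ hN
  refine mem_interior_iff_mem_nhds.2 (Filter.mem_of_superset hN ?_)
  rintro v ⟨hvs, hvb⟩
  have key : ∀ l : F →L[ℂ] ℂ, ∀ z ∈ Metric.ball (χ x) r,
      conj (l (e ⟨σ.base (χ.symm z), s (σ.base (χ.symm z))⟩).2) -
        conj (l (e (σ.total ⟨χ.symm z, t (χ.symm z)⟩)).2) = 0 := by
    intro l z hz
    refine eq_zero_of_forall_ball_of_eventually (c := χ x) (r := r) (w := χ w)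
      (f := fun z => conj (l (e ⟨σ.base (χ.symm z), s (σ.base (χ.symm z))⟩).2) -
        conj (l (e (σ.total ⟨χ.symm z, t (χ.symm z)⟩)).2)) ?_ hwb ?_ hz
    · intro z hz
      exact ((σ.differentiableAt_section_base s e l x (hball z hz).1 (hball z hz).2).sub
        (σ.differentiableAt_total_section t e l x (hball z hz).1
          (hball z hz).2)).differentiableWithinAt
    · have hc : ContinuousAt χ.symm (χ w) := χ.continuousAt_symm (χ.map_source hws)
      have hw' : S ∈ 𝓝 (χ.symm (χ w)) := by
        rw [χ.left_inv hws]
        exact mem_interior_iff_mem_nhds.1 hwS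
      filter_upwards [hc.preimage_mem_nhds hw'] with z hz
      have hz' : s (σ.base (χ.symm z)) = σ.fiber (χ.symm z) (t (χ.symm z)) := hz
      rw [hz', total, sub_self]
  refine e.eq_of_forall_dual (x := σ.base v) ?_ fun l => ?_
  · have := (hball _ hvb).2
    rwa [χ.left_inv hvs] at this
  · have := key l _ hvb
    rw [χ.left_inv hvs, sub_eq_zero] at this
    exact (starRingEnd ℂ).injective this

end AntiholomorphicBundleEnd

variable {𝓗 : Type*} [NormedAddCommGroup 𝓗] [InnerProductSpace ℂ 𝓗] [CompleteSpace 𝓗]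
  [FiniteDimensional ℂ F] {T : 𝓗 →ₗ[ℂ] HolomorphicSection E F V}
  {hT : Continuous[inferInstance, compactConvergence E F V] T}

/-- Polarization of a relation between `A` and the map `σ`: if it holds over the diagonal of
`D × D`, then it holds everywhere. -/
theorem inner_coherentVector_of_diagonal [ConnectedSpace D] (σ : AntiholomorphicBundleEnd E F V)
    (A : 𝓗 →L[ℂ] 𝓗)
    (hdiag : ∀ x (u v : V x),
      ⟪coherentVector T hT (σ.total ⟨x, u⟩), A (coherentVector T hT (σ.total ⟨x, v⟩))⟫_ℂ =
        ⟪coherentVector T hT ⟨x, v⟩, A (coherentVector T hT ⟨x, u⟩)⟫_ℂ)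
    (p q : Bundle.TotalSpace F V) :
    ⟪coherentVector T hT (σ.total p), A (coherentVector T hT (σ.total q))⟫_ℂ =
      ⟪coherentVector T hT q, A (coherentVector T hT p)⟫_ℂ := by
  obtain ⟨x₀, v₀⟩ := q
  have (x : D) : FiniteDimensional ℂ (V x) := VectorBundle.finiteDimensional_fiber F V x
  have (x : D) : CompleteSpace (V x) := FiniteDimensional.complete ℂ (V x)
  set S := coherentVector T hT
  obtain ⟨r, hr, hball⟩ := σ.exists_ball_subset x₀
  set χ := chartAt E x₀
  set e := trivializationAt F V (σ.base x₀)
  -- vectors whose images under `σ` represent the functionals `l ∘ e`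
  let w : (F →L[ℂ] ℂ) → ∀ y, V y := fun l y =>
    (InnerProductSpace.toDual ℂ (V y)).symm (l.comp (e.continuousLinearMapAt ℂ y))
  let v : (F →L[ℂ] ℂ) → ∀ y, V y := fun l y => (σ.fiber y).symm (w l (σ.base y))
  have hσv : ∀ l y, σ.fiber y (v l y) = w l (σ.base y) := fun l y => by simp [v]
  have hw : ∀ l y, y ∈ e.baseSet → ∀ u : V y, ⟪w l y, u⟫_ℂ = l (e ⟨y, u⟩).2 := by
    intro l y hy u
    simp [w, e.coe_linearMapAt_of_mem hy]
  -- The frame `v l` is chosen so that pairing with `a` or `b` reads off the l-coordinate of a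
  -- section over σ y, or the conjugate l-coordinate of its σ-image.
  let a : (F →L[ℂ] ℂ) → E → 𝓗 := fun l z => S (σ.total ⟨χ.symm z, v l (χ.symm z)⟩)
  let b : (F →L[ℂ] ℂ) → E → 𝓗 := fun l z => S ⟨χ.symm z, v l (χ.symm z)⟩
  have ha_inner : ∀ l z, z ∈ Metric.ball (χ x₀) r → ∀ f, ⟪a l z, f⟫_ℂ =
      l (e ⟨σ.base (χ.symm z), T f (σ.base (χ.symm z))⟩).2 := by
    intro l z hz f
    rw [inner_coherentVector, ← hw l _ (hball z hz).2, ← hσv]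
    rfl
  have hb_inner : ∀ l z, z ∈ Metric.ball (χ x₀) r → ∀ f, ⟪b l z, f⟫_ℂ =
      conj (l (e (σ.total ⟨χ.symm z, T f (χ.symm z)⟩)).2) := by
    intro l z hz f
    rw [inner_coherentVector, AntiholomorphicBundleEnd.total, ← hw l _ (hball z hz).2, ← hσv,
      inner_conj_symm, inner_map_map_of_conj]
  have ha : ∀ l f, DifferentiableOn ℂ (fun z => ⟪f, a l z⟫_ℂ) (Metric.ball (χ x₀) r) := by
    intro l f
    refine DifferentiableOn.congr (fun z hz => (σ.differentiableAt_section_base (T f) e l x₀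
      (hball z hz).1 (hball z hz).2).differentiableWithinAt) fun z hz => ?_
    rw [← inner_conj_symm, ha_inner l z hz]
  have hb : ∀ l f, DifferentiableOn ℂ (fun z => ⟪b l z, f⟫_ℂ) (Metric.ball (χ x₀) r) := by
    intro l f
    exact DifferentiableOn.congr (fun z hz => (σ.differentiableAt_total_section (T f) e l x₀
      (hball z hz).1 (hball z hz).2).differentiableWithinAt) fun z hz => hb_inner l z hz f
  obtain ⟨l, hl⟩ : ∃ l, v l x₀ = v₀ := by
    have hx₀ : σ.base x₀ ∈ e.baseSet := FiberBundle.mem_baseSet_trivializationAt' _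
    refine ⟨(innerSL ℂ (σ.fiber x₀ v₀)).comp (e.symmL ℂ (σ.base x₀)), ?_⟩
    refine (σ.fiber x₀).injective (ext_inner_right ℂ fun u => ?_)
    rw [hσv, hw _ _ hx₀]
    have := e.symmL_continuousLinearMapAt (R := ℂ) hx₀ u
    simpa [e.coe_linearMapAt_of_mem hx₀] using
      congr(⟪σ.fiber x₀ v₀, $this⟫_ℂ)
  have hx₀ : χ.symm (χ x₀) = x₀ := χ.left_inv (mem_chart_source E x₀)
  have hv₀ : (⟨χ.symm (χ x₀), v l (χ.symm (χ x₀))⟩ : Bundle.TotalSpace F V) = ⟨x₀, v₀⟩ := by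
    rw [hx₀, hl]
  have hal : a l (χ x₀) = S (σ.total ⟨x₀, v₀⟩) := congr(S (σ.total $hv₀))
  have hbl : b l (χ x₀) = S ⟨x₀, v₀⟩ := congr(S $hv₀)
  -- With q fixed, polarization near x₀ becomes an equality of fiber values of two sections related
  -- by σ, which the identity theorem extends to all of D.
  have hev : ∀ᶠ y in 𝓝 x₀, T (A (S (σ.total ⟨x₀, v₀⟩))) (σ.base y) =
      σ.fiber y (T (A.adjoint (S ⟨x₀, v₀⟩)) y) := by
    have hN : χ.source ∩ χ ⁻¹' Metric.ball (χ x₀) (r / 2) ∈ 𝓝 x₀ :=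
      (χ.continuousAt (mem_chart_source E x₀)).preimage_mem_nhds
        (Metric.ball_mem_nhds _ (half_pos hr)) |>
        Filter.inter_mem (χ.open_source.mem_nhds (mem_chart_source E x₀))
    filter_upwards [hN] with y hy
    have hyr : χ y ∈ Metric.ball (χ x₀) r := Metric.ball_subset_ball (half_le_self hr.le) hy.2
    have hye := (hball _ hyr).2
    rw [χ.left_inv hy.1] at hye
    refine e.eq_of_forall_dual hye fun m => ?_
    have := inner_eq_of_forall_diagonal (ha m) (ha l) (hb m) (hb l) A
      (fun z _ => hdiag (χ.symm z) (v m (χ.symm z)) (v l (χ.symm z))) hy.2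
    rw [hal, hbl, ha_inner m _ hyr, ← ContinuousLinearMap.adjoint_inner_left, ← inner_conj_symm,
      hb_inner m _ hyr, Complex.conj_conj, χ.left_inv hy.1] at this
    exact this
  have := σ.section_eq_of_eventually hev p.1
  rw [inner_coherentVector, AntiholomorphicBundleEnd.total, this, inner_map_map_of_conj,
    ← ContinuousLinearMap.adjoint_inner_left, ← inner_conj_symm (𝕜 := ℂ) _ (S p),
    inner_coherentVector, inner_conj_symm]

end Realization

/-! ### Equivariance and the identity on the diagonal -/

section Equivariance

variable {E : Type*} [NormedAddCommGroup E] [NormedSpace ℂ E]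
  {D : Type*} [TopologicalSpace D] [ChartedSpace E D]
  {F : Type*} [NormedAddCommGroup F] [NormedSpace ℂ F]
  {V : D → Type*} [TopologicalSpace (Bundle.TotalSpace F V)]
  [∀ x, NormedAddCommGroup (V x)] [∀ x, InnerProductSpace ℂ (V x)]
  [FiberBundle F V]
  {H : Type*} [Group H] [MulAction H D]

open scoped InnerProductSpace

theorem HolomorphicBundleAction.act_injective (a : HolomorphicBundleAction E F V H) (h : H) :
    Function.Injective (a.act h) := fun p q hpq => by
  rw [← a.act_one p, ← a.act_one q, ← inv_mul_cancel h, a.act_mul, a.act_mul, hpq]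

/-- If `σ` and `h` agree on the base at `x`, they differ over `x` by an anti-unitary operator. -/
theorem AntiholomorphicBundleEnd.exists_total_eq_act (σ : AntiholomorphicBundleEnd E F V)
    (a : HolomorphicBundleAction E F V H) {x : D} {h : H} (hx : σ.base x = h • x) :
    ∃ τ : V x ≃ₛₗᵢ[starRingEnd ℂ] V x, ∀ v, σ.total ⟨x, v⟩ = a.act h ⟨x, τ v⟩ := by
  refine ⟨(σ.fiber x).trans ((fiberCongr V hx).trans (a.L h x).symm), fun v => ?_⟩
  simp only [HolomorphicBundleAction.act, LinearIsometryEquiv.trans_apply,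
    LinearIsometryEquiv.apply_symm_apply]
  exact (mk_fiberCongr hx _).symm

variable {𝓗 : Type*} [NormedAddCommGroup 𝓗] [InnerProductSpace ℂ 𝓗]

theorem inner_map_left_eq_inner_inv (U : H →* (𝓗 ≃ₗᵢ[ℂ] 𝓗)) (h : H) (f g : 𝓗) :
    ⟪U h f, g⟫_ℂ = ⟪f, U h⁻¹ g⟫_ℂ := by
  have : U h (U h⁻¹ g) = g := by
    have := congr($(map_mul U h h⁻¹) g)
    rw [mul_inv_cancel, map_one] at this
    exact this.symm
  rw [← LinearIsometryEquiv.inner_map_map (U h) f, this]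

variable [CompleteSpace 𝓗]

/-- The commutant of a unitary representation. -/
def commutant (U : H →* (𝓗 ≃ₗᵢ[ℂ] 𝓗)) : StarSubalgebra ℂ (𝓗 →L[ℂ] 𝓗) :=
  StarSubalgebra.centralizer ℂ (Set.range fun h => ((U h).toContinuousLinearEquiv : 𝓗 →L[ℂ] 𝓗))

/-- The star-centralizer also demands commuting with adjoints, which is automatic since U(h)* =
U(h⁻¹). -/
theorem mem_commutant {U : H →* (𝓗 ≃ₗᵢ[ℂ] 𝓗)} {A : 𝓗 →L[ℂ] 𝓗} :
    A ∈ commutant U ↔ ∀ h f, A (U h f) = U h (A f) := by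
  have hstar : ∀ h, star ((U h).toContinuousLinearEquiv : 𝓗 →L[ℂ] 𝓗) =
      ((U h⁻¹).toContinuousLinearEquiv : 𝓗 →L[ℂ] 𝓗) := fun h => by
    ext f
    refine ext_inner_left ℂ fun g => ?_
    rw [ContinuousLinearMap.star_eq_adjoint, ContinuousLinearMap.adjoint_inner_right]
    exact inner_map_left_eq_inner_inv U h g f
  rw [commutant, StarSubalgebra.mem_centralizer_iff]
  constructor
  · intro hA h f
    exact congr($((hA _ ⟨h, rfl⟩).1) f).symm
  · rintro hA _ ⟨h, rfl⟩
    refine ⟨ContinuousLinearMap.ext fun f => (hA h f).symm, ?_⟩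
    simp only [hstar]
    exact ContinuousLinearMap.ext fun f => (hA h⁻¹ f).symm

variable [VectorBundle ℂ F V] {T : 𝓗 →ₗ[ℂ] HolomorphicSection E F V}
  {hT : Continuous[inferInstance, compactConvergence E F V] T}

theorem coherentVector_act {a : HolomorphicBundleAction E F V H} {U : H →* (𝓗 ≃ₗᵢ[ℂ] 𝓗)}
    (hU : ∀ (h : H) (f : 𝓗) (x : D), T (U h f) (h • x) = a.L h x (T f x)) (h : H)
    (p : Bundle.TotalSpace F V) :
    coherentVector T hT (a.act h p) = U h (coherentVector T hT p) := by
  refine ext_inner_right ℂ fun f => ?_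
  obtain ⟨g, rfl⟩ := (U h).surjective f
  rw [LinearIsometryEquiv.inner_map_map, inner_coherentVector, inner_coherentVector]
  simp only [HolomorphicBundleAction.act, hU]
  exact (a.L h p.1).inner_map_map _ _

/-- The operator on the fiber at `x` given by the reproducing kernel of `A` on the diagonal. -/
theorem exists_kernel_diagonal [FiniteDimensional ℂ F] (A : 𝓗 →L[ℂ] 𝓗) (x : D) :
    ∃ K : V x →L[ℂ] V x, ∀ u v,
      ⟪u, K v⟫_ℂ = ⟪coherentVector T hT ⟨x, u⟩, A (coherentVector T hT ⟨x, v⟩)⟫_ℂ := by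
  have : FiniteDimensional ℂ (V x) := VectorBundle.finiteDimensional_fiber F V x
  have : CompleteSpace (V x) := FiniteDimensional.complete ℂ (V x)
  refine ⟨(evalCLM T hT x).comp (A.comp (evalCLM T hT x).adjoint), fun u v => ?_⟩
  have hv : coherentVector T hT ⟨x, v⟩ = (evalCLM T hT x).adjoint v := by
    refine ext_inner_right ℂ fun f => ?_
    rw [inner_coherentVector, ContinuousLinearMap.adjoint_inner_left, evalCLM_apply]
  rw [inner_coherentVector, hv]
  rfl

theorem inner_coherentVector_total_self [FiniteDimensional ℂ F]
    {a : HolomorphicBundleAction E F V H} {U : H →* (𝓗 ≃ₗᵢ[ℂ] 𝓗)}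
    (hU : ∀ (h : H) (f : 𝓗) (x : D), T (U h f) (h • x) = a.L h x (T f x))
    {x : D} (hx : IsMultiplicityFree (a.isotropyRep x)) {n : ℕ}
    {W : Fin n → Subrepresentation (unitaryToRepresentation (a.isotropyRep x))}
    (hW : IsIrreducibleDecomposition W) (σ : AntiholomorphicBundleEnd E F V)
    {h : H} (hσ : σ.base x = h • x)
    (hσW : ∀ i, (fun v : V x => σ.total ⟨x, v⟩) '' (W i : Set (V x)) =
      (fun v : V x => a.act h ⟨x, v⟩) '' (W i : Set (V x)))
    {A : 𝓗 →L[ℂ] 𝓗} (hA : ∀ h f, A (U h f) = U h (A f)) (u v : V x) :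
    ⟪coherentVector T hT (σ.total ⟨x, u⟩), A (coherentVector T hT (σ.total ⟨x, v⟩))⟫_ℂ =
      ⟪coherentVector T hT ⟨x, v⟩, A (coherentVector T hT ⟨x, u⟩)⟫_ℂ := by
  have : FiniteDimensional ℂ (V x) := VectorBundle.finiteDimensional_fiber F V x
  obtain ⟨K, hK⟩ := exists_kernel_diagonal (hT := hT) A x
  obtain ⟨τ, hτ⟩ := σ.exists_total_eq_act a hσ
  -- The kernel is invariant under simultaneous translation by `H`; at the fixed point x this says
  -- that K intertwines.
  have hiso : ∀ g v, K (a.isotropyRep x g v) = a.isotropyRep x g (K v) := by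
    intro g v
    refine ext_inner_left ℂ fun w => ?_
    obtain ⟨w, rfl⟩ := (a.isotropyRep x g).surjective w
    have hg : ∀ v, (⟨x, a.isotropyRep x g v⟩ : Bundle.TotalSpace F V) = a.act g ⟨x, v⟩ :=
      fun v => a.mk_isotropyOp x g v
    rw [LinearIsometryEquiv.inner_map_map, hK, hK, hg, hg, coherentVector_act hU,
      coherentVector_act hU, hA, LinearIsometryEquiv.inner_map_map]
  have hτW : ∀ i, ∀ v ∈ (W i).toSubmodule, τ v ∈ (W i).toSubmodule := by
    intro i v hv
    obtain ⟨w, hw, hwv⟩ := (hσW i).subset ⟨v, hv, rfl⟩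
    have : (⟨x, w⟩ : Bundle.TotalSpace F V) = ⟨x, τ v⟩ :=
      a.act_injective h (hwv.trans (hτ v))
    rw [← Bundle.TotalSpace.mk_injective x this]
    exact hw
  rw [hτ, hτ, coherentVector_act hU, coherentVector_act hU, hA, LinearIsometryEquiv.inner_map_map,
    ← hK, ← hK]
  exact hx.inner_conj_eq hW hiso τ hτW u v

end Equivariance

end

/-! ### The main theorem -/

theorem theorem2p2
    {E : Type*} [NormedAddCommGroup E] [NormedSpace ℂ E] [FiniteDimensional ℂ E]
    {D : Type*} [TopologicalSpace D] [ChartedSpace E D] [IsManifold 𝓘(ℂ, E) ω D]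
    [T2Space D] [ConnectedSpace D]
    {F : Type*} [NormedAddCommGroup F] [NormedSpace ℂ F] [FiniteDimensional ℂ F]
    {V : D → Type*} [TopologicalSpace (Bundle.TotalSpace F V)]
    [∀ x, NormedAddCommGroup (V x)] [∀ x, InnerProductSpace ℂ (V x)]
    [FiberBundle F V] [VectorBundle ℂ F V] [ContMDiffVectorBundle ω F V 𝓘(ℂ, E)]
    [IsHermitianBundle E F V]
    {EH : Type*} [NormedAddCommGroup EH] [NormedSpace ℝ EH] [FiniteDimensional ℝ EH]
    {H : Type*} [TopologicalSpace H] [ChartedSpace EH H] [Group H] [LieGroup 𝓘(ℝ, EH) ∞ H]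
    [MulAction H D]
    (a : HolomorphicBundleAction E F V H)
    (hfiber : ∀ x : D, IsMultiplicityFree (a.isotropyRep x))
    (n : D → ℕ)
    (W : ∀ x : D, Fin (n x) → Subrepresentation (unitaryToRepresentation (a.isotropyRep x)))
    (hW : ∀ x : D, IsIrreducibleDecomposition (W x))
    (σ : AntiholomorphicBundleEnd E F V)
    (hσ : ∀ x : D, ∃ h : H, σ.base x = h • x ∧
      ∀ i : Fin (n x),
        (fun v : V x => σ.total ⟨x, v⟩) '' (W x i : Set (V x)) =
          (fun v : V x => a.act h ⟨x, v⟩) '' (W x i : Set (V x)))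
    {𝓗 : Type*} [NormedAddCommGroup 𝓗] [InnerProductSpace ℂ 𝓗] [CompleteSpace 𝓗]
    (U : H →* (𝓗 ≃ₗᵢ[ℂ] 𝓗)) (hU : ∀ f : 𝓗, Continuous fun h : H => U h f)
    (hreal : a.IsRealized U) :
    IsMultiplicityFree U := by
  obtain ⟨T, hinj, hT, hequiv⟩ := hreal
  intro A B hA hB
  refine mul_comm_of_anti_pairing_of_span (S := coherentVector T hT)
    (S' := fun p => coherentVector T hT (σ.total p)) (span_coherentVector hinj)
    (M := commutant U) ?_ (mem_commutant.2 hA) (mem_commutant.2 hB)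
  intro C hC p q
  refine inner_coherentVector_of_diagonal σ C (fun x u v => ?_) p q
  obtain ⟨h, hx, hσW⟩ := hσ x
  exact inner_coherentVector_total_self hequiv (hfiber x) (hW x) σ hx hσW (mem_commutant.1 hC) u v
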